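/- Fix a first order language with equality, with countably many variables $x_0,x_1,\dots$, and suppose that each function symbol (constants included) is declared to be either rigid or non-rigid. A model $M=(W,D,I)$ consists of a set $W$ of worlds, a non-empty domain $D$ and, for each world $w\in W$, an interpretation $I_w$ of all predicate and function symbols on $D$, such that rigid function symbols have the same interpretation in every world. For a formula $\phi$, possibly with free variables, let $$[?\phi]_M=\{(w,v)\in W^2 \mid \text{for every assignment } g:\ M,w,g\models\phi \Leftrightarrow M,v,g\models\phi\},$$ and for a set $\Phi$ of formulas let $[?\Phi]_M=\bigcap_{\phi\in\Phi}[?\phi]_M$ (which is $W^2$ if $\Phi=\emptyset$). Write $?\phi\models{?\psi}$ if $[?\phi]_M\subseteq[?\psi]_M$ for every model $M$, and $?\Phi\models{?\psi}$ if $[?\Phi]_M\subseteq[?\psi]_M$ for every model $M$. A formula $\psi$ without free variables is an answer to $?\phi$ (respectively to $?\Phi$) if $?\phi\models{?\psi}$ (respectively $?\Phi\models{?\psi}$). A term is rigid if it is composed of variables and rigid function symbols. A rigid instance of a formula $\phi$ is a formula obtained from $\phi$ by uniformly substituting rigid terms for its free variables (avoiding capture). A development of a set $\Phi$ of formulas is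 a formula built up from rigid instances of elements of $\Phi$, identity statements $s\approx t$ between rigid terms $s,t$, and $\top,\bot$, using boolean connectives and quantifiers. A development of $\phi$ is a development of $\{\phi\}$. Two formulas are logically equivalent if they have the same truth value in every (non-empty) first order structure under every assignment. Let $\psi$ be a formula without free variables. Then: 1. For every formula $\phi$, $\psi$ is an answer to $?\phi$ if and only if $\psi$ is logically equivalent to a development of $\phi$. 2. For every set $\Phi$ of formulas, $\psi$ is an answer to $?\Phi$ if and only if $\psi$ is logically equivalent to a development of $\Phi$. -/

import Mathlib

universe u v w w'

namespace Interrogation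

open FirstOrder FirstOrder.Language

/-- A first order modal structure `(W, D, I)` with constant non-empty domain `D`: every world
interprets all the symbols of `L` on `D`, and rigid function symbols (constants included) have
the same extension in every world. -/
structure ModalModel (L : FirstOrder.Language.{u, v}) (rigid : ∀ n, L.Functions n → Prop) where
  World : Type w'
  Domain : Type w
  domain_nonempty : Nonempty Domain
  interp : World → L.Structure Domain
  interp_rigid : ∀ (n : ℕ) (f : L.Functions n), rigid n f →
    ∀ (a b : World) (x : Fin n → Domain), (interp a).funMap f x = (interp b).funMap f x

variable {L : FirstOrder.Language.{u, v}} {rigid : ∀ n, L.Functions n → Prop}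

namespace ModalModel

/-- `M, a, g ⊨ φ`. -/
def Sat (M : ModalModel.{u, v, w, w'} L rigid) (a : M.World) (g : ℕ → M.Domain)
    (φ : L.Formula ℕ) : Prop :=
  letI : L.Structure M.Domain := M.interp a
  φ.Realize g

/-- The relation `[?φ]_M` on worlds. -/
def partition (M : ModalModel.{u, v, w, w'} L rigid) (φ : L.Formula ℕ) :
    Set (M.World × M.World) :=
  {p | ∀ g : ℕ → M.Domain, M.Sat p.1 g φ ↔ M.Sat p.2 g φ}

/-- The relation `[?Φ]_M` on worlds, for a set `Φ` of formulas. -/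
def setPartition (M : ModalModel.{u, v, w, w'} L rigid) (Φ : Set (L.Formula ℕ)) :
    Set (M.World × M.World) :=
  ⋂ φ ∈ Φ, M.partition φ

end ModalModel

/-- `?φ ⊨ ?ψ`. -/
def Entails (rigid : ∀ n, L.Functions n → Prop) (φ ψ : L.Formula ℕ) : Prop :=
  ∀ M : ModalModel.{u, v, w, w'} L rigid, M.partition φ ⊆ M.partition ψ

/-- `?Φ ⊨ ?ψ`. -/
def SetEntails (rigid : ∀ n, L.Functions n → Prop) (Φ : Set (L.Formula ℕ))
    (ψ : L.Formula ℕ) : Prop :=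
  ∀ M : ModalModel.{u, v, w, w'} L rigid, M.setPartition Φ ⊆ M.partition ψ

/-- A formula without free variables. -/
def IsSentence (ψ : L.Formula ℕ) : Prop :=
  BoundedFormula.freeVarFinset ψ = ∅

/-- The sentence `ψ` is an answer to `?φ`. -/
def IsAnswer (rigid : ∀ n, L.Functions n → Prop) (φ ψ : L.Formula ℕ) : Prop :=
  IsSentence ψ ∧ Entails.{u, v, w, w'} rigid φ ψ

/-- The sentence `ψ` is an answer to the set of questions `?Φ`. -/
def IsAnswerToSet (rigid : ∀ n, L.Functions n → Prop) (Φ : Set (L.Formula ℕ))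
    (ψ : L.Formula ℕ) : Prop :=
  IsSentence ψ ∧ SetEntails.{u, v, w, w'} rigid Φ ψ

/-- A term is rigid if it is composed of variables and rigid function symbols. -/
inductive IsRigidTerm (rigid : ∀ n, L.Functions n → Prop) {α : Type} : L.Term α → Prop
  | var (a : α) : IsRigidTerm rigid (Term.var a)
  | func {n : ℕ} (f : L.Functions n) (ts : Fin n → L.Term α) (hf : rigid n f)
      (hts : ∀ i, IsRigidTerm rigid (ts i)) : IsRigidTerm rigid (Term.func f ts)

/-- `χ` is a rigid instance of `φ`: it is obtained by uniformly substituting rigid terms for the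
free variables of `φ`. As `χ` may stand in the scope of `n` quantifiers, those terms may contain
the variables `0, …, n - 1` bound by them, besides the variables of the language. -/
def IsRigidInstance (rigid : ∀ n, L.Functions n → Prop) (φ : L.Formula ℕ) {n : ℕ}
    (χ : L.BoundedFormula ℕ n) : Prop :=
  ∃ σ : ℕ → L.Term (ℕ ⊕ Fin n), (∀ i, IsRigidTerm rigid (σ i)) ∧
    χ = BoundedFormula.relabel (id : ℕ ⊕ Fin n → ℕ ⊕ Fin n) (BoundedFormula.subst φ σ)

/-- Developments of a set `Φ` of formulas: built up from rigid instances of elements of `Φ`, rigid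
identity statements and `⊥` by means of `→` and `∀`. The other connectives, `∃` and `⊤` are
abbreviations in terms of these (for instance `∼φ` is `φ.imp ⊥` and `⊤` is `∼⊥`). -/
inductive IsSetDevelopment (rigid : ∀ n, L.Functions n → Prop) (Φ : Set (L.Formula ℕ)) :
    ∀ {n : ℕ}, L.BoundedFormula ℕ n → Prop
  | falsum {n : ℕ} : IsSetDevelopment rigid Φ (⊥ : L.BoundedFormula ℕ n)
  | rigidInstance {n : ℕ} (φ : L.Formula ℕ) (hφ : φ ∈ Φ) (χ : L.BoundedFormula ℕ n)
      (hχ : IsRigidInstance rigid φ χ) : IsSetDevelopment rigid Φ χ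
  | rigidIdentity {n : ℕ} (s t : L.Term (ℕ ⊕ Fin n)) (hs : IsRigidTerm rigid s)
      (ht : IsRigidTerm rigid t) : IsSetDevelopment rigid Φ (s.bdEqual t)
  | imp {n : ℕ} {χ₁ χ₂ : L.BoundedFormula ℕ n} (h₁ : IsSetDevelopment rigid Φ χ₁)
      (h₂ : IsSetDevelopment rigid Φ χ₂) : IsSetDevelopment rigid Φ (χ₁.imp χ₂)
  | all {n : ℕ} {χ : L.BoundedFormula ℕ (n + 1)} (h : IsSetDevelopment rigid Φ χ) :
      IsSetDevelopment rigid Φ χ.all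

/-- `θ` is a development of the single formula `φ`. -/
def IsDevelopment (rigid : ∀ n, L.Functions n → Prop) (φ : L.Formula ℕ)
    (θ : L.Formula ℕ) : Prop :=
  IsSetDevelopment rigid {φ} θ

/-- Logical equivalence: the two formulas have the same truth value in every non-empty first order
structure under every assignment. -/
def LogicallyEquivalent (ψ θ : L.Formula ℕ) : Prop :=
  FirstOrder.Language.Theory.Iff (∅ : L.Theory) ψ θ

end Interrogation

-- Worlds that agree on `Φ` agree on every development of `Φ`, since rigid terms have the same value
-- in both and the quantifiers range over one domain. This gives the direction from developments to
-- answers. For the converse, the heart is that an answer cannot separate assignments in two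
-- structures that satisfy the same developments (`SetEntails.realize_iff`). Elementary extensions
-- of the two structures are realized on a common domain, where they satisfy the same developments
-- (`DevelopmentMap.exists_amalgam`), and are taken as the two worlds of a modal model. Rigid
-- symbols agree there because `F x = y` is a development for rigid `F`; the questions agree because
-- each member of `Φ` is equivalent to a development. The common domain is the union of an
-- alternating chain whose even and odd members form two elementary chains. Compactness then turns
-- this invariance into a single equivalent development (`SetEntails.exists_development`).

universe x y

namespace Interrogation

open FirstOrder FirstOrder.Language

variable {L : FirstOrder.Language.{u, v}} {rigid : ∀ n, L.Functions n → Prop}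
  {Φ : Set (L.Formula ℕ)}

/-! ### Compactness and dependence on free variables -/

/-- Compactness for sets of formulas with free variables. -/
theorem exists_realize_of_forall_finset {α : Type x} (S : Set (L.Formula α))
    (h : ∀ S₀ : Finset S, ∃ (M : Type y) (_ : L.Structure M) (_ : Nonempty M) (g : α → M),
      ∀ φ ∈ S₀, φ.1.Realize g) :
    ∃ (M : Type (max u v x y)) (_ : L.Structure M) (_ : Nonempty M) (g : α → M),
      ∀ φ ∈ S, φ.Realize g := by
  choose M str ne g hg using h
  -- Every `φ ∈ S` belongs to all sufficiently large `S₀`, so an ultrafilter finer than `atTop`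
  -- makes Łoś's theorem yield all of `S`.
  let U : Ultrafilter (Finset S) := Ultrafilter.of Filter.atTop
  refine ⟨(U : Filter (Finset S)).Product M, inferInstance, inferInstance,
    fun a => ((fun i => g i a : ∀ i, M i) : (U : Filter (Finset S)).Product M), ?_⟩
  intro φ hφ
  refine (Ultraproduct.realize_formula_cast φ fun a i => g i a).2 ?_
  have : ∀ᶠ S₀ : Finset S in Filter.atTop, (⟨φ, hφ⟩ : S) ∈ S₀ := by
    filter_upwards [Filter.eventually_ge_atTop {(⟨φ, hφ⟩ : S)}] with S₀ h₀
    exact h₀ (Finset.mem_singleton_self _)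
  exact Filter.Eventually.mono (Ultrafilter.of_le Filter.atTop this) fun S₀ h₀ => hg S₀ _ h₀

theorem realize_congr_of_freeVar {M : Type y} [L.Structure M] (φ : L.Formula ℕ) {g h : ℕ → M}
    (hgh : ∀ i ∈ BoundedFormula.freeVarFinset φ, g i = h i) : φ.Realize g ↔ φ.Realize h := by
  unfold Formula.Realize
  rw [← BoundedFormula.realize_restrictFreeVar (φ := φ) (f := Subtype.val) (v := g) g
      (fun _ => rfl),
    BoundedFormula.realize_restrictFreeVar (f := Subtype.val) (v := g) h
      (fun a => hgh a.1 a.2)]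

/-! ### Closure properties of developments -/

theorem IsRigidTerm.relabel {α β : Type} {t : L.Term α} (ht : IsRigidTerm rigid t) (τ : α → β) :
    IsRigidTerm rigid (t.relabel τ) := by
  induction ht with
  | var a => exact .var _
  | func f ts hf _ ih => exact .func f _ hf ih

theorem realize_rigidInstance {M : Type y} [L.Structure M] (φ : L.Formula ℕ) {n : ℕ}
    (σ : ℕ → L.Term (ℕ ⊕ Fin n)) (g : ℕ → M) (xs : Fin n → M) :
    BoundedFormula.Realize (l := n)
      (BoundedFormula.relabel (id : ℕ ⊕ Fin n → ℕ ⊕ Fin n) (BoundedFormula.subst φ σ)) g xs ↔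
      φ.Realize fun i => (σ i).realize (Sum.elim g xs) := by
  refine (BoundedFormula.realize_relabel (m := n) (n := 0)).trans ?_
  rw [BoundedFormula.realize_subst]
  exact iff_of_eq (congrArg _ (Subsingleton.elim _ _))

/-- Developments are closed under renaming of free and bound variables. -/
theorem IsSetDevelopment.exists_relabel {n : ℕ} {θ : L.BoundedFormula ℕ n}
    (hθ : IsSetDevelopment rigid Φ θ) {m : ℕ} (τ : ℕ ⊕ Fin n → ℕ ⊕ Fin m) :
    ∃ θ' : L.BoundedFormula ℕ m, IsSetDevelopment rigid Φ θ' ∧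
      ∀ (M : Type y) [L.Structure M] (g : ℕ → M) (xs : Fin m → M), θ'.Realize g xs ↔
        θ.Realize (Sum.elim g xs ∘ τ ∘ Sum.inl) (Sum.elim g xs ∘ τ ∘ Sum.inr) := by
  induction hθ generalizing m with
  | falsum => exact ⟨⊥, .falsum, fun M _ g xs => Iff.rfl⟩
  | @rigidInstance n φ hφ χ hχ =>
    obtain ⟨σ, hσ, rfl⟩ := hχ
    refine ⟨_, .rigidInstance φ hφ _ ⟨fun i => (σ i).relabel τ, fun i => (hσ i).relabel τ, rfl⟩,
      fun M _ g xs => ?_⟩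
    rw [realize_rigidInstance]
    refine Iff.trans ?_ (realize_rigidInstance φ σ _ _).symm
    simp only [Term.realize_relabel, ← Function.comp_assoc, Sum.elim_comp_inl_inr]
  | rigidIdentity s t hs ht =>
    refine ⟨_, .rigidIdentity _ _ (hs.relabel τ) (ht.relabel τ), fun M _ g xs => ?_⟩
    simp only [BoundedFormula.realize_bdEqual, Term.realize_relabel, ← Function.comp_assoc,
      Sum.elim_comp_inl_inr]
  | imp _ _ ih₁ ih₂ =>
    obtain ⟨θ₁, h₁, e₁⟩ := ih₁ τ
    obtain ⟨θ₂, h₂, e₂⟩ := ih₂ τ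
    exact ⟨_, .imp h₁ h₂, fun M _ g xs => by
      simp only [BoundedFormula.realize_imp, e₁, e₂]⟩
  | @all n χ _ ih =>
    -- Old variables follow `τ`; the newly bound variable is sent to the new last one.
    obtain ⟨θ, h, e⟩ := ih (m := m + 1) (Sum.elim
      (Sum.map id Fin.castSucc ∘ τ ∘ Sum.inl)
      (Fin.snoc (α := fun _ => ℕ ⊕ Fin (m + 1)) (Sum.map id Fin.castSucc ∘ τ ∘ Sum.inr)
        (Sum.inr (Fin.last m))))
    refine ⟨_, .all h, fun M _ g xs => ?_⟩
    simp only [BoundedFormula.realize_all, e]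
    refine forall_congr' fun a => iff_of_eq ?_
    have key : ∀ z : ℕ ⊕ Fin m, Sum.elim g (Fin.snoc (α := fun _ => M) xs a)
        (Sum.map id Fin.castSucc z) = Sum.elim g xs z := by
      rintro (i | i)
      · rfl
      · simp
    congr 1
    · funext i
      exact key _
    · funext i
      refine Fin.lastCases ?_ (fun i => ?_) i
      · simp
      · simpa using key _

theorem IsSetDevelopment.exists_rename {θ : L.Formula ℕ} (hθ : IsSetDevelopment rigid Φ θ)
    (ρ : ℕ → ℕ) :
    ∃ θ' : L.Formula ℕ, IsSetDevelopment rigid Φ θ' ∧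
      ∀ (M : Type y) [L.Structure M] (g : ℕ → M), θ'.Realize g ↔ θ.Realize (g ∘ ρ) := by
  obtain ⟨θ', h, e⟩ := hθ.exists_relabel (m := 0) (Sum.map ρ id)
  refine ⟨θ', h, fun M _ g => (e M g _).trans (iff_of_eq ?_)⟩
  exact congrArg₂ _ rfl (Subsingleton.elim _ _)

theorem IsSetDevelopment.not {n : ℕ} {θ : L.BoundedFormula ℕ n} (hθ : IsSetDevelopment rigid Φ θ) :
    IsSetDevelopment rigid Φ θ.not :=
  hθ.imp .falsum

theorem IsSetDevelopment.inf {n : ℕ} {θ₁ θ₂ : L.BoundedFormula ℕ n}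
    (h₁ : IsSetDevelopment rigid Φ θ₁) (h₂ : IsSetDevelopment rigid Φ θ₂) :
    IsSetDevelopment rigid Φ (θ₁ ⊓ θ₂) :=
  (h₁.imp h₂.not).not

theorem IsSetDevelopment.top {n : ℕ} : IsSetDevelopment rigid Φ (⊤ : L.BoundedFormula ℕ n) :=
  IsSetDevelopment.falsum.not

theorem IsSetDevelopment.of_mem {φ : L.Formula ℕ} (hφ : φ ∈ Φ) :
    ∃ θ : L.Formula ℕ, IsSetDevelopment rigid Φ θ ∧
      ∀ (M : Type y) [L.Structure M] (g : ℕ → M), θ.Realize g ↔ φ.Realize g :=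
  ⟨_, .rigidInstance φ hφ _ ⟨fun i => Term.var (Sum.inl i), fun _ => .var _, rfl⟩,
    fun _ _ g => realize_rigidInstance φ _ g _⟩

theorem IsSetDevelopment.of_identity {s t : L.Term ℕ} (hs : IsRigidTerm rigid s)
    (ht : IsRigidTerm rigid t) :
    IsSetDevelopment rigid Φ (s.equal t) :=
  .rigidIdentity _ _ (hs.relabel _) (ht.relabel _)

/-- Developments are closed under existential quantification over a finite set of variables. -/
theorem IsSetDevelopment.exists_ex {θ : L.Formula ℕ} (hθ : IsSetDevelopment rigid Φ θ)
    (F : Finset ℕ) :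
    ∃ θ' : L.Formula ℕ, IsSetDevelopment rigid Φ θ' ∧
      ∀ (M : Type y) [L.Structure M] (g : ℕ → M), θ'.Realize g ↔
        ∃ c : ℕ → M, (∀ i ∉ F, c i = g i) ∧ θ.Realize c := by
  induction F using Finset.induction_on with
  | empty =>
    refine ⟨θ, hθ, fun M _ g => ⟨fun h => ⟨g, fun _ _ => rfl, h⟩, ?_⟩⟩
    rintro ⟨c, hc, h⟩
    rwa [← funext fun i => hc i (Finset.notMem_empty i)]
  | insert j F hj ih =>
    obtain ⟨θ₁, h₁, e₁⟩ := ih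
    -- The free variable `j` becomes the bound variable `0`, and `∃` is written as `¬∀¬`.
    obtain ⟨θ₂, h₂, e₂⟩ := h₁.exists_relabel (m := 1)
      (Sum.elim (fun i => if i = j then Sum.inr 0 else Sum.inl i) finZeroElim)
    refine ⟨θ₂.not.all.not, h₂.not.all.not, fun M _ g => ?_⟩
    have key : Formula.Realize (θ₂.not.all.not) g ↔
        ∃ a : M, θ₁.Realize (Function.update g j a) := by
      simp only [Formula.Realize, BoundedFormula.realize_not, BoundedFormula.realize_all,
        not_forall, not_not]
      refine exists_congr fun a => (e₂ M g _).trans (iff_of_eq (congrArg₂ _ (funext fun i => ?_)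
        (Subsingleton.elim _ _)))
      by_cases hi : i = j
      · subst hi
        simp [Fin.snoc]
      · simp [hi]
    rw [key]
    simp only [e₁]
    constructor
    · rintro ⟨a, c, hc, h⟩
      refine ⟨c, fun i hi => ?_, h⟩
      rw [Finset.mem_insert, not_or] at hi
      rw [hc i hi.2, Function.update_of_ne hi.1]
    · rintro ⟨c, hc, h⟩
      refine ⟨c j, c, fun i hi => ?_, h⟩
      by_cases hij : i = j
      · subst hij
        simp
      · rw [Function.update_of_ne hij, hc i (by simp [hij, hi])]

/-- Two worlds that agree on the questions in `Φ` agree on all developments of `Φ`. -/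
theorem IsSetDevelopment.realize_iff {n : ℕ} {θ : L.BoundedFormula ℕ n}
    (hθ : IsSetDevelopment rigid Φ θ) (M : ModalModel.{u, v, w, w'} L rigid) {a b : M.World}
    (hab : (a, b) ∈ M.setPartition Φ) (g : ℕ → M.Domain) (xs : Fin n → M.Domain) :
    @BoundedFormula.Realize L M.Domain (M.interp a) _ _ θ g xs ↔
      @BoundedFormula.Realize L M.Domain (M.interp b) _ _ θ g xs := by
  have term : ∀ {α : Type} {t : L.Term α}, IsRigidTerm rigid t → ∀ s : α → M.Domain,
      @Term.realize L M.Domain (M.interp a) _ s t =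
        @Term.realize L M.Domain (M.interp b) _ s t := by
    intro α t ht s
    induction ht with
    | var => rfl
    | func f ts hf _ ih =>
      simp only [Term.realize, ih]
      exact M.interp_rigid _ f hf a b _
  induction hθ with
  | falsum => exact Iff.rfl
  | rigidInstance φ hφ χ hχ =>
    obtain ⟨σ, hσ, rfl⟩ := hχ
    refine (@realize_rigidInstance L M.Domain (M.interp a) φ _ σ g xs).trans
      (Iff.trans ?_ (@realize_rigidInstance L M.Domain (M.interp b) φ _ σ g xs).symm)
    simp only [term (hσ _)]
    exact (Set.mem_iInter₂.1 hab φ hφ) _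
  | rigidIdentity s t hs ht =>
    refine (@BoundedFormula.realize_bdEqual L M.Domain (M.interp a) _ _ g xs s t).trans
      (Iff.trans ?_ (@BoundedFormula.realize_bdEqual L M.Domain (M.interp b) _ _ g xs s t).symm)
    rw [term hs, term ht]
  | imp _ _ ih₁ ih₂ => exact imp_congr (ih₁ xs) (ih₂ xs)
  | all _ ih => exact forall_congr' fun c => ih _

/-! ### Tuples with the same developments, and one amalgamation step -/

/-- The tuples `g` and `h`, indexed by the same type, satisfy the same developments. -/
def SameDevelopments (rigid : ∀ n, L.Functions n → Prop) (Φ : Set (L.Formula ℕ)) {α : Type*}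
    {M N : Type*} [L.Structure M] [L.Structure N] (g : α → M) (h : α → N) : Prop :=
  ∀ θ : L.Formula ℕ, IsSetDevelopment rigid Φ θ → ∀ r : ℕ → α,
    θ.Realize (g ∘ r) ↔ θ.Realize (h ∘ r)

/-- Identity of two variables is a development; hence `h a ↦ g a` is well defined and injective. -/
theorem SameDevelopments.eq_iff {α : Type*} {M N : Type*} [L.Structure M] [L.Structure N]
    {g : α → M} {h : α → N} (H : SameDevelopments rigid Φ g h) (a b : α) :
    g a = g b ↔ h a = h b := by
  have := H _ (.of_identity (.var 0) (.var 1)) (fun i => if i = 0 then a else b)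
  simpa using this

/-- The function `k`, extending `h a ↦ g a`, can be chosen so as to preserve one given fact. -/
theorem SameDevelopments.exists_extension {α : Type*} [Nonempty α] {M N : Type y} [L.Structure M]
    [L.Structure N] {g : α → M} {h : α → N} (H : SameDevelopments rigid Φ g h) {θ : L.Formula ℕ}
    (hθ : IsSetDevelopment rigid Φ θ) {d : ℕ → N} (hd : θ.Realize d) :
    ∃ k : N → M, k ∘ h = g ∧ θ.Realize (k ∘ d) := by
  classical
  -- `ρ` selects one index for each value of `d`, so that variables with equal values are merged and
  -- the witnesses found in `M` define a function of the value.
  let ρ : ℕ → ℕ := fun i => Function.invFun d (d i)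
  have hρ : ∀ i, d (ρ i) = d i := fun i => Function.invFun_eq ⟨i, rfl⟩
  obtain ⟨θ₁, h₁, e₁⟩ := hθ.exists_rename.{u, v, y} ρ
  -- Variables with values outside the range of `h` are quantified away; what remains has parameters
  -- in that range, so `H` carries it to `M`.
  let F : Finset ℕ := (BoundedFormula.freeVarFinset θ₁ ∪
    (BoundedFormula.freeVarFinset θ).image ρ).filter fun i => d i ∉ Set.range h
  obtain ⟨θ₂, h₂, e₂⟩ := h₁.exists_ex.{u, v, y} F
  let r : ℕ → α := fun i => if hi : d i ∈ Set.range h then hi.choose else Classical.arbitrary α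
  have hr : ∀ i, d i ∈ Set.range h → h (r i) = d i := fun i hi => by
    simp only [r, dif_pos hi]
    exact hi.choose_spec
  have hN : θ₂.Realize (h ∘ r) := by
    refine (e₂ N _).2 ⟨fun i => if i ∈ F then d i else h (r i), fun i hi => by simp [hi], ?_⟩
    refine (realize_congr_of_freeVar θ₁ fun i hi => ?_).1 ((e₁ N d).2 (by
      rwa [show d ∘ ρ = d from funext hρ]))
    by_cases hiF : i ∈ F
    · simp [hiF]
    · have : d i ∈ Set.range h := by
        by_contra hc
        exact hiF (by simp only [F, Finset.mem_filter, Finset.mem_union]; exact ⟨.inl hi, hc⟩)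
      simp [hiF, hr i this]
  obtain ⟨c, hc, hcθ⟩ := (e₂ M _).1 ((H θ₂ h₂ r).2 hN)
  let k : N → M := fun n => if hn : n ∈ Set.range h then g hn.choose else c (Function.invFun d n)
  have hk : ∀ a, k (h a) = g a := fun a => by
    have ha : h a ∈ Set.range h := ⟨a, rfl⟩
    simp only [k, dif_pos ha]
    exact (H.eq_iff _ _).2 ha.choose_spec
  refine ⟨k, funext hk, (realize_congr_of_freeVar θ fun i hi => ?_).1 ((e₁ M c).1 hcθ)⟩
  change c (ρ i) = k (d i)
  by_cases hi' : d i ∈ Set.range h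
  · have hi'' : d (ρ i) ∈ Set.range h := by rwa [hρ]
    have : ρ i ∉ F := fun hF => (Finset.mem_filter.1 hF).2 hi''
    rw [hc _ this, ← hρ i, ← hr _ hi'', hk]
    rfl
  · simp only [k, dif_neg hi']
    rfl

/-- Finitely many developments with parameters can be merged into a single one. -/
theorem exists_merge {N : Type y} [L.Structure N] [Nonempty N] {ι : Type*} (s : Finset ι)
    (θ : ι → L.Formula ℕ) (r : ι → ℕ → N) (hθ : ∀ i ∈ s, IsSetDevelopment rigid Φ (θ i))
    (hr : ∀ i ∈ s, (θ i).Realize (r i)) :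
    ∃ (θ' : L.Formula ℕ) (d : ℕ → N), IsSetDevelopment rigid Φ θ' ∧ θ'.Realize d ∧
      ∀ (M : Type y) [L.Structure M] (k : N → M), θ'.Realize (k ∘ d) →
        ∀ i ∈ s, (θ i).Realize (k ∘ r i) := by
  classical
  induction s using Finset.induction_on with
  | empty => exact ⟨⊤, fun _ => Classical.arbitrary N, .top, by simp [Formula.Realize], by simp⟩
  | insert j s _ ih =>
    obtain ⟨θ₁, d₁, h₁, t₁, e₁⟩ := ih (fun i hi => hθ i (Finset.mem_insert_of_mem hi))
      (fun i hi => hr i (Finset.mem_insert_of_mem hi))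
    -- Even and odd variables keep the two families of parameters apart.
    obtain ⟨θ₂, h₂, e₂⟩ := h₁.exists_rename.{u, v, y} (fun i => 2 * i)
    obtain ⟨θ₃, h₃, e₃⟩ :=
      (hθ j (Finset.mem_insert_self j s)).exists_rename.{u, v, y} (fun i => 2 * i + 1)
    let d : ℕ → N := fun i => if Even i then d₁ (i / 2) else r j (i / 2)
    have hd₁ : d ∘ (fun i => 2 * i) = d₁ := by
      funext i
      simp [d]
    have hd₂ : d ∘ (fun i => 2 * i + 1) = r j := by
      funext i
      have : (2 * i + 1) / 2 = i := by omega
      simp [d, this]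
    refine ⟨θ₂ ⊓ θ₃, d, h₂.inf h₃, ?_, fun M _ k hk => ?_⟩
    · refine BoundedFormula.realize_inf.2 ⟨(e₂ N d).2 ?_, (e₃ N d).2 ?_⟩
      · rwa [hd₁]
      · rw [hd₂]
        exact hr j (Finset.mem_insert_self j s)
    · obtain ⟨k₁, k₂⟩ := BoundedFormula.realize_inf.1 hk
      have k₁ := (e₂ M _).1 k₁
      have k₂ := (e₃ M _).1 k₂
      rw [Function.comp_assoc, hd₁] at k₁
      rw [Function.comp_assoc, hd₂] at k₂
      intro i hi
      rcases Finset.mem_insert.1 hi with rfl | hi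
      · exact k₂
      · exact e₁ M k k₁ i hi

/-- One step of the amalgamation: an elementary extension of `M` receives all of `N`. -/
theorem SameDevelopments.exists_elementaryExtension {α : Type*} [Nonempty α]
    {M N : Type (max u v w)} [L.Structure M] [L.Structure N] {g : α → M} {h : α → N}
    (H : SameDevelopments rigid Φ g h) :
    ∃ (M' : Type (max u v w)) (_ : L.Structure M') (e : M ↪ₑ[L] M') (g' : N → M'),
      g' ∘ h = e ∘ g ∧ SameDevelopments rigid Φ g' (id : N → N) := by
  classical
  have : Nonempty M := ⟨g (Classical.arbitrary α)⟩
  have : Nonempty N := ⟨h (Classical.arbitrary α)⟩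
  -- `S₁` is the elementary diagram of `M`, `S₂` glues `h a` to `g a`, and `S₃` is the diagram of
  -- `N` restricted to developments.
  let S₁ : Set (L.Formula (N ⊕ M)) := {φ | ∃ φ₀ : L.Formula M, φ₀.Realize id ∧
    φ = φ₀.relabel Sum.inr}
  let S₂ : Set (L.Formula (N ⊕ M)) := {φ | ∃ a : α,
    φ = (Term.var (Sum.inl (h a))).equal (Term.var (Sum.inr (g a)))}
  let S₃ : Set (L.Formula (N ⊕ M)) := {φ | ∃ (θ : L.Formula ℕ) (r : ℕ → N),
    IsSetDevelopment rigid Φ θ ∧ θ.Realize r ∧ φ = θ.relabel (Sum.inl ∘ r)}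
  obtain ⟨M', str, _, s, hs⟩ := exists_realize_of_forall_finset.{u, v, max u v w, max u v w}
      (S₁ ∪ S₂ ∪ S₃) (by
    intro S₀
    have : ∀ φ : L.Formula (N ⊕ M), ∃ (θ : L.Formula ℕ) (r : ℕ → N),
        IsSetDevelopment rigid Φ θ ∧ θ.Realize r ∧ (φ ∈ S₃ → φ = θ.relabel (Sum.inl ∘ r)) := by
      intro φ
      by_cases hφ : φ ∈ S₃
      · obtain ⟨θ, r, h₁, h₂, h₃⟩ := hφ
        exact ⟨θ, r, h₁, h₂, fun _ => h₃⟩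
      · exact ⟨⊤, fun _ => Classical.arbitrary N, .top, by simp [Formula.Realize],
          fun h => absurd h hφ⟩
    choose θ r h₁ h₂ h₃ using this
    -- A finite part is satisfied in `M` itself: its facts from `S₃` merge into one development,
    -- which a suitable `k : N → M` preserves.
    obtain ⟨θ', d, hθ', hd, hmerge⟩ := exists_merge S₀ (fun φ => θ φ.1) (fun φ => r φ.1)
      (fun φ _ => h₁ φ.1) (fun φ _ => h₂ φ.1)
    obtain ⟨k, hk, hkd⟩ := H.exists_extension hθ' hd
    refine ⟨M, inferInstance, inferInstance, Sum.elim k id, ?_⟩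
    rintro ⟨φ, (⟨φ₀, hφ₀, rfl⟩ | ⟨a, rfl⟩) | hφ⟩ hmem
    · rw [Formula.realize_relabel]
      exact hφ₀
    · simpa using congrFun hk a
    · have := hmerge M k hkd _ hmem
      change φ.Realize _
      rw [h₃ φ hφ, Formula.realize_relabel]
      exact this)
  refine ⟨M', str, ⟨s ∘ Sum.inr, ?_⟩, s ∘ Sum.inl, ?_, ?_⟩
  · have key : ∀ n (φ : L.Formula (Fin n)) (a : Fin n → M), φ.Realize a →
        φ.Realize ((s ∘ Sum.inr) ∘ a) := by
      intro n φ a hφ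
      have := hs _ (.inl (.inl ⟨φ.relabel a, (Formula.realize_relabel).2 hφ, rfl⟩))
      simpa [Formula.realize_relabel] using this
    intro n φ a
    refine ⟨fun hφ => ?_, key n φ a⟩
    by_contra hc
    exact (Formula.realize_not.1 (key n φ.not a (Formula.realize_not.2 hc))) hφ
  · funext a
    exact Formula.realize_equal.1 (hs _ (.inl (.inr ⟨a, rfl⟩)))
  · have key : ∀ θ : L.Formula ℕ, IsSetDevelopment rigid Φ θ → ∀ r : ℕ → N, θ.Realize r →
        θ.Realize ((s ∘ Sum.inl) ∘ r) := by
      intro θ hθ r hr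
      have := hs _ (.inr ⟨θ, r, hθ, hr, rfl⟩)
      rwa [Formula.realize_relabel] at this
    -- Developments are closed under negation, so one-way preservation suffices.
    intro θ hθ r
    refine ⟨fun h => ?_, key θ hθ r⟩
    by_contra hc
    exact (Formula.realize_not.1 (key _ hθ.not r (Formula.realize_not.2 hc))) h

/-! ### Unions of chains -/

/-- The union of an increasing chain of types. -/
theorem exists_colimit (K : ℕ → Type x) (f : ∀ n, K n → K (n + 1))
    (hf : ∀ n, Function.Injective (f n)) :
    ∃ (X : Type x) (ι : ∀ n, K n → X), (∀ n, Function.Injective (ι n)) ∧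
      (∀ n a, ι (n + 1) (f n a) = ι n a) ∧ ∀ x, ∃ n a, ι n a = x := by
  -- Over the empty language, the direct limit of structures is the direct limit of sets.
  let : ∀ n, Language.empty.Structure (K n) := fun n => Language.emptyStructure
  let F : ∀ n, K n ↪[Language.empty] K (n + 1) := fun n =>
    { toFun := f n
      inj' := hf n
      map_fun' := fun g => isEmptyElim g
      map_rel' := fun r => isEmptyElim r }
  refine ⟨Language.DirectLimit K (DirectedSystem.natLERec F),
    fun n => Language.DirectLimit.of Language.empty ℕ K (DirectedSystem.natLERec F) n,
    fun n => (Language.DirectLimit.of Language.empty ℕ K (DirectedSystem.natLERec F) n).injective,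
    fun n a => ?_, Language.DirectLimit.exists_of⟩
  have : f n a = DirectedSystem.natLERec F n (n + 1) n.le_succ a := by
    rw [DirectedSystem.coe_natLERec]
    exact (Nat.leRecOn_succ' (C := K) (next := fun {k} => F k) a).symm
  rw [this]
  exact Language.DirectLimit.of_f

section Chain

variable {A : ℕ → Type x} {X : Type x} {ι : ∀ n, A n → X}

theorem exists_lift_of_le {f : ∀ n, A n → A (n + 1)} (hι : ∀ n a, ι (n + 1) (f n a) = ι n a)
    {n m : ℕ} (hnm : n ≤ m) : ∃ t : A n → A m, ∀ a, ι m (t a) = ι n a := by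
  induction m, hnm using Nat.le_induction with
  | base => exact ⟨id, fun _ => rfl⟩
  | succ m _ ih =>
    obtain ⟨t, ht⟩ := ih
    exact ⟨f m ∘ t, fun a => (hι m _).trans (ht a)⟩

/-- A finite tuple of elements of the union lies in all large enough members of the chain. -/
theorem exists_forall_ge_exists_lift {f : ∀ n, A n → A (n + 1)}
    (hι : ∀ n a, ι (n + 1) (f n a) = ι n a) (hsurj : ∀ x, ∃ n a, ι n a = x) {β : Type*} [Finite β]
    (x : β → X) : ∃ N, ∀ n ≥ N, ∃ z : β → A n, ι n ∘ z = x := by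
  choose m a ha using fun b => hsurj (x b)
  obtain ⟨N, hN⟩ := Set.finite_range m |>.bddAbove
  refine ⟨N, fun n hn => ?_⟩
  have h : ∀ b, m b ≤ n := fun b => (hN ⟨b, rfl⟩).trans hn
  choose t ht using fun b => exists_lift_of_le hι (h b)
  exact ⟨fun b => t b (a b), funext fun b => (ht b _).trans (ha b)⟩

variable [∀ n, L.Structure (A n)]

/-- The union of an elementary chain is an elementary extension of its members. -/
theorem exists_structure_of_elementaryChain (e : ∀ n, A n ↪ₑ[L] A (n + 1))
    (hinj : ∀ n, Function.Injective (ι n)) (hι : ∀ n a, ι (n + 1) (e n a) = ι n a)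
    (hsurj : ∀ x, ∃ n a, ι n a = x) :
    ∃ _ : L.Structure X, ∀ {α : Type y} {k : ℕ} (φ : L.BoundedFormula α k) (n : ℕ) (g : α → A n)
      (xs : Fin k → A n), φ.Realize (ι n ∘ g) (ι n ∘ xs) ↔ φ.Realize g xs := by
  have trans : ∀ {n m : ℕ}, n ≤ m → ∃ t : A n ↪ₑ[L] A m, ∀ a, ι m (t a) = ι n a := by
    intro n m hnm
    induction m, hnm using Nat.le_induction with
    | base => exact ⟨.refl L _, fun _ => rfl⟩
    | succ m _ ih =>
      obtain ⟨t, ht⟩ := ih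
      exact ⟨(e m).comp t, fun a => (hι m _).trans (ht a)⟩
  have lift : ∀ {k : ℕ} (x : Fin k → X), ∃ n, ∃ z : Fin k → A n, ι n ∘ z = x := fun x =>
    let ⟨N, hN⟩ := exists_forall_ge_exists_lift (f := fun n => e n) hι hsurj x
    ⟨N, hN N le_rfl⟩
  choose lev rep hrep using @lift
  -- Symbols are evaluated at an arbitrarily chosen level; `common` compares it with any other level
  -- inside a later one.
  let S : L.Structure X :=
    { funMap := fun F x => ι _ (Structure.funMap F (rep x))
      RelMap := fun R x => Structure.RelMap R (rep x) }
  have common : ∀ {k n : ℕ} (z : Fin k → A n), ∃ (m : ℕ) (t : A n ↪ₑ[L] A m)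
      (t' : A (lev (ι n ∘ z)) ↪ₑ[L] A m), (∀ a, ι m (t a) = ι n a) ∧
        (∀ a, ι m (t' a) = ι _ a) ∧ t ∘ z = t' ∘ rep (ι n ∘ z) := by
    intro k n z
    obtain ⟨t, ht⟩ := trans (le_max_left n (lev (ι n ∘ z)))
    obtain ⟨t', ht'⟩ := trans (le_max_right n (lev (ι n ∘ z)))
    refine ⟨_, t, t', ht, ht', funext fun i => hinj _ ?_⟩
    exact (ht _).trans ((congrFun (hrep (ι n ∘ z)) i).symm.trans (ht' _).symm)
  have funMap_eq : ∀ {k n : ℕ} (F : L.Functions k) (z : Fin k → A n),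
      Structure.funMap F (ι n ∘ z) = ι n (Structure.funMap F z) := by
    intro k n F z
    obtain ⟨m, t, t', ht, ht', h⟩ := common z
    change ι _ (Structure.funMap F (rep (ι n ∘ z))) = _
    rw [← ht', ← ht, t.map_fun, t'.map_fun, h]
  have relMap_iff : ∀ {k n : ℕ} (R : L.Relations k) (z : Fin k → A n),
      Structure.RelMap R (ι n ∘ z) ↔ Structure.RelMap R z := by
    intro k n R z
    obtain ⟨m, t, t', ht, ht', h⟩ := common z
    change Structure.RelMap R (rep (ι n ∘ z)) ↔ _
    rw [← t.map_rel, ← t'.map_rel, h]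
  have term : ∀ {β : Type y} (s : L.Term β) (n : ℕ) (g : β → A n),
      s.realize (ι n ∘ g) = ι n (s.realize g) := by
    intro β s n g
    induction s with
    | var => rfl
    | func F ts ih =>
      simp only [Term.realize, ih]
      exact funMap_eq F _
  refine ⟨S, fun {α k} φ => ?_⟩
  induction φ with
  | falsum => exact fun n g xs => Iff.rfl
  | equal s t =>
    intro n g xs
    simp only [BoundedFormula.Realize, ← Sum.comp_elim, term]
    exact (hinj n).eq_iff
  | rel R ts =>
    intro n g xs
    simp only [BoundedFormula.Realize, ← Sum.comp_elim, term]
    exact relMap_iff R _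
  | imp _ _ ih₁ ih₂ => exact fun n g xs => imp_congr (ih₁ n g xs) (ih₂ n g xs)
  | all φ ih =>
    intro n g xs
    constructor
    · intro h a
      refine (ih n g _).1 ?_
      rw [Fin.comp_snoc]
      exact h (ι n a)
    · intro h b
      -- The element `b` may come from a level beyond `n`; elementarity moves the universal
      -- statement to a level containing it.
      obtain ⟨m, a, rfl⟩ := hsurj b
      obtain ⟨t, ht⟩ := trans (le_max_left n m)
      obtain ⟨t', ht'⟩ := trans (le_max_right n m)
      have h' := (t.map_boundedFormula φ.all g xs).2 h (t' a)
      have h'' := (ih _ _ _).2 h'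
      rw [Fin.comp_snoc, ht', ← Function.comp_assoc, ← Function.comp_assoc,
        show ι (max n m) ∘ t = ι n from funext ht] at h''
      exact h''

end Chain

/-! ### The alternating chain and the common domain -/

theorem SameDevelopments.symm {α : Type*} {M N : Type*} [L.Structure M] [L.Structure N]
    {g : α → M} {h : α → N} (H : SameDevelopments rigid Φ g h) : SameDevelopments rigid Φ h g :=
  fun θ hθ r => (H θ hθ r).symm

/-- A map of structures that preserves the developments of `Φ`. -/
structure DevelopmentMap (rigid : ∀ n, L.Functions n → Prop) (Φ : Set (L.Formula ℕ)) where
  Source : Type x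
  Target : Type x
  [nonempty : Nonempty Source]
  [sourceStructure : L.Structure Source]
  [targetStructure : L.Structure Target]
  toFun : Source → Target
  preserves : SameDevelopments rigid Φ (id : Source → Source) toFun

attribute [instance] DevelopmentMap.nonempty DevelopmentMap.sourceStructure
  DevelopmentMap.targetStructure

/-- The extension step swaps roles: the new map starts at the old target, and its composite with the
old map is elementary. This makes every second member of the chain an elementary extension. -/
theorem DevelopmentMap.exists_next (P : DevelopmentMap.{u, v, max u v w} rigid Φ) :
    ∃ Q : Σ (C : Type (max u v w)) (_ : L.Structure C), P.Target → C,
      letI := Q.2.1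
      SameDevelopments rigid Φ (id : P.Target → P.Target) Q.2.2 ∧
        ∃ e : P.Source ↪ₑ[L] Q.1, ∀ a, e a = Q.2.2 (P.toFun a) := by
  obtain ⟨C, str, e, g, h, hg⟩ := P.preserves.exists_elementaryExtension
  exact ⟨⟨C, str, g⟩, hg.symm, e, fun a => (congrFun h a).symm⟩

/-- The next map of the alternating chain. -/
noncomputable def DevelopmentMap.next (P : DevelopmentMap.{u, v, max u v w} rigid Φ) :
    DevelopmentMap.{u, v, max u v w} rigid Φ :=
  letI := P.exists_next.choose.2.1
  { Source := P.Target
    Target := P.exists_next.choose.1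
    nonempty := P.nonempty.map P.toFun
    toFun := P.exists_next.choose.2.2
    preserves := P.exists_next.choose_spec.1 }

/-- The alternating chain starting with a given map. -/
noncomputable def DevelopmentMap.chain (P : DevelopmentMap.{u, v, max u v w} rigid Φ) :
    ℕ → DevelopmentMap.{u, v, max u v w} rigid Φ
  | 0 => P
  | n + 1 => (P.chain n).next

theorem DevelopmentMap.injective (P : DevelopmentMap.{u, v, x} rigid Φ) :
    Function.Injective P.toFun :=
  fun a b h => (P.preserves.eq_iff a b).2 h

/-- The source and the target of a map preserving developments have elementary extensions with a
common domain that satisfy the same developments. -/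
theorem DevelopmentMap.exists_amalgam (P : DevelopmentMap.{u, v, max u v w} rigid Φ) :
    ∃ (X : Type (max u v w)) (S T : L.Structure X) (ι : P.Source → X) (κ : P.Target → X),
      (∀ a, κ (P.toFun a) = ι a) ∧
      (∀ (φ : L.Formula ℕ) (g : ℕ → P.Source),
        @Formula.Realize L X S ℕ φ (ι ∘ g) ↔ φ.Realize g) ∧
      (∀ (φ : L.Formula ℕ) (g : ℕ → P.Target),
        @Formula.Realize L X T ℕ φ (κ ∘ g) ↔ φ.Realize g) ∧
      ∀ θ : L.Formula ℕ, IsSetDevelopment rigid Φ θ → ∀ g : ℕ → X,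
        @Formula.Realize L X S ℕ θ g ↔ @Formula.Realize L X T ℕ θ g := by
  let K : ℕ → Type (max u v w) := fun n => (P.chain n).Source
  let f : ∀ n, K n → K (n + 1) := fun n => (P.chain n).toFun
  have e : ∀ n, ∃ e : K n ↪ₑ[L] K (n + 2), ∀ a, e a = f (n + 1) (f n a) :=
    fun n => (P.chain n).exists_next.choose_spec.2
  choose e he using e
  obtain ⟨X, ι, hinj, hι, hsurj⟩ := exists_colimit K f fun n => (P.chain n).injective
  -- For each parity `p`, the members `2 * n + p` form an elementary chain with union `X`; parities
  -- `0` and `1` give the two structures.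
  have lim : ∀ p : ℕ, ∃ S : L.Structure X, ∀ (φ : L.Formula ℕ) (n : ℕ) (g : ℕ → K (2 * n + p)),
      @Formula.Realize L X S ℕ φ (ι _ ∘ g) ↔ φ.Realize g := by
    intro p
    have e' : ∀ n, ∃ e' : K (2 * n + p) ↪ₑ[L] K (2 * (n + 1) + p),
        ∀ a, ι (2 * (n + 1) + p) (e' a) = ι (2 * n + p) a := by
      intro n
      rw [show 2 * (n + 1) + p = 2 * n + p + 2 by ring]
      exact ⟨e _, fun a => by rw [he, hι, hι]⟩
    choose e' he' using e'
    obtain ⟨S, hS⟩ := exists_structure_of_elementaryChain.{u, v, max u v w, 0}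
      (A := fun n => K (2 * n + p)) (ι := fun n => ι (2 * n + p)) e'
      (fun n => hinj _) he' (fun x => by
        obtain ⟨m, a, rfl⟩ := hsurj x
        obtain ⟨t, ht⟩ := exists_lift_of_le hι (show m ≤ 2 * m + p by omega)
        exact ⟨m, t a, ht a⟩)
    refine ⟨S, fun φ n g => Iff.trans (iff_of_eq ?_) (hS φ n g default)⟩
    exact congrArg (@BoundedFormula.Realize L X S ℕ 0 φ (ι _ ∘ g)) (Subsingleton.elim _ _)
  obtain ⟨S, hS⟩ := lim 0
  obtain ⟨T, hT⟩ := lim 1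
  refine ⟨X, S, T, ι 0, ι 1, hι 0, fun φ g => hS φ 0 g, fun φ g => hT φ 0 g, fun θ hθ g => ?_⟩
  -- Truth in `S` is read off at level `2 * n`, truth in `T` at the next level; the map between them
  -- preserves developments.
  have agree : ∀ n (z : ℕ → K (2 * n + 0)),
      @Formula.Realize L X S ℕ θ (ι _ ∘ z) ↔ @Formula.Realize L X T ℕ θ (ι _ ∘ z) := by
    intro n z
    refine (hS θ n z).trans (((P.chain (2 * n)).preserves θ hθ z).trans ?_)
    refine (hT θ n (f (2 * n) ∘ z)).symm.trans (iff_of_eq (congrArg _ ?_))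
    exact funext fun i => hι _ _
  -- Only the finitely many free variables of `θ` matter, and their values lie in one even level.
  obtain ⟨N, hN⟩ := exists_forall_ge_exists_lift hι hsurj
    (fun i : BoundedFormula.freeVarFinset θ => g i)
  obtain ⟨z, hz⟩ := hN (2 * N + 0) (by omega)
  classical
  obtain ⟨b⟩ : Nonempty (K (2 * N + 0)) := (P.chain (2 * N)).nonempty
  let z' : ℕ → K (2 * N + 0) := fun i =>
    if hi : i ∈ BoundedFormula.freeVarFinset θ then z ⟨i, hi⟩ else b
  have hz' : ∀ i ∈ BoundedFormula.freeVarFinset θ, g i = (ι _ ∘ z') i := fun i hi => by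
    simp only [z', Function.comp_apply, dif_pos hi]
    exact (congrFun hz ⟨i, hi⟩).symm
  exact (@realize_congr_of_freeVar L X S θ _ _ hz').trans ((agree N z').trans
    (@realize_congr_of_freeVar L X T θ _ _ hz').symm)

/-! ### Invariance of answers via a two-world model -/

/-- An answer is invariant under agreement on developments. -/
theorem SetEntails.realize_iff {ψ : L.Formula ℕ}
    (hψ : SetEntails.{u, v, max u v w, w'} rigid Φ ψ) {M N : Type (max u v w)} [L.Structure M]
    [L.Structure N] {g : ℕ → M} {h : ℕ → N} (H : SameDevelopments rigid Φ g h) :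
    ψ.Realize g ↔ ψ.Realize h := by
  obtain ⟨M', str, e, g', hg', H'⟩ := H.exists_elementaryExtension
  let P : DevelopmentMap.{u, v, max u v w} rigid Φ :=
    { Source := N
      Target := M'
      nonempty := ⟨h 0⟩
      toFun := g'
      preserves := H'.symm }
  obtain ⟨X, S, T, ι, κ, hικ, hι, hκ, hST⟩ := P.exists_amalgam
  let Mod : ModalModel.{u, v, max u v w, w'} L rigid :=
    { World := ULift Bool
      Domain := X
      domain_nonempty := ⟨ι (h 0)⟩
      interp := fun b => cond b.down S T
      interp_rigid := by
        have key : ∀ (n : ℕ) (F : L.Functions n), rigid n F → ∀ x : Fin n → X,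
            S.funMap F x = T.funMap F x := by
          intro n F hF x
          -- The arguments occupy variables below `n`, and variable `n` holds the value in `S`; the
          -- identity stating this is rigid, so it also holds in `T`.
          let c : ℕ → X := fun i => if hi : i < n then x ⟨i, hi⟩ else S.funMap F x
          have hc : (fun i : Fin n => c i) = x := funext fun i => by simp [c]
          have hcn : c n = S.funMap F x := by simp [c]
          have hdev : IsSetDevelopment rigid Φ
              ((Term.var n).equal (Term.func F fun i => Term.var (i : ℕ)) : L.Formula ℕ) :=
            .of_identity (.var n) (.func F _ hF fun i => .var _)
          have h₁ := hST _ hdev c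
          rw [@Formula.realize_equal L X S, @Formula.realize_equal L X T] at h₁
          simp only [Term.realize, hc, hcn] at h₁
          exact h₁.1 trivial
        rintro n F hF ⟨a⟩ ⟨b⟩ x
        cases a <;> cases b <;> simp [key n F hF x] }
  have hmem : ((⟨true⟩, ⟨false⟩) : Mod.World × Mod.World) ∈ Mod.setPartition Φ := by
    refine Set.mem_iInter₂.2 fun φ hφ c => ?_
    obtain ⟨θ, hθ, hφθ⟩ := IsSetDevelopment.of_mem.{u, v, max u v w} (rigid := rigid) hφ
    exact (@hφθ X S c).symm.trans ((hST θ hθ c).trans (@hφθ X T c))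
  have hS : ψ.Realize h ↔ @Formula.Realize L X S ℕ ψ (ι ∘ h) := (hι ψ h).symm
  -- Gluing gives `κ ∘ e ∘ g = κ ∘ g' ∘ h = ι ∘ h`, so both worlds are tested at one assignment.
  have hT : ψ.Realize g ↔ @Formula.Realize L X T ℕ ψ (ι ∘ h) := by
    rw [← e.map_formula ψ g, ← hg']
    refine (hκ ψ (g' ∘ h)).symm.trans (iff_of_eq (congrArg _ ?_))
    exact funext fun i => hικ (h i)
  exact hT.trans ((hψ Mod hmem (ι ∘ h)).symm.trans hS.symm)

/-! ### From invariance to a single development -/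

theorem exists_development_realize_iff_forall {ι : Type*} (s : Finset ι) (θ : ι → L.Formula ℕ)
    (hθ : ∀ i ∈ s, IsSetDevelopment rigid Φ (θ i)) :
    ∃ θ' : L.Formula ℕ, IsSetDevelopment rigid Φ θ' ∧
      ∀ (M : Type y) [L.Structure M] (g : ℕ → M),
        θ'.Realize g ↔ ∀ i ∈ s, (θ i).Realize g := by
  classical
  induction s using Finset.induction_on with
  | empty => exact ⟨⊤, .top, fun M _ g => by simp [Formula.Realize]⟩
  | insert j s _ ih =>
    obtain ⟨θ', h, e⟩ := ih fun i hi => hθ i (Finset.mem_insert_of_mem hi)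
    refine ⟨θ j ⊓ θ', (hθ j (Finset.mem_insert_self j s)).inf h, fun M _ g => ?_⟩
    rw [Finset.forall_mem_insert, ← e M g]
    exact BoundedFormula.realize_inf

/-- Moves logical equivalence to the universe of the modal domains; `ULift` brings it back. -/
theorem logicallyEquivalent_iff {ψ θ : L.Formula ℕ} :
    LogicallyEquivalent ψ θ ↔ ∀ (M : Type (max u v w)) [L.Structure M] [Nonempty M] (g : ℕ → M),
      ψ.Realize g ↔ θ.Realize g := by
  constructor
  · intro h M _ _ g
    have : M ⊨ (∅ : L.Theory) := by simp
    exact Theory.Iff.realize_iff h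
  · intro h M g xs
    let E : M ≃ ULift.{w} M := Equiv.ulift.symm
    let := E.inducedStructure (L := L)
    have key : ∀ φ : L.Formula ℕ, φ.Realize (E ∘ g) ↔ φ.Realize g := fun φ =>
      StrongHomClass.realize_formula (E.inducedStructureEquiv (L := L)) φ
    have := h (ULift.{w} M) (E ∘ g)
    rw [key, key] at this
    rw [Subsingleton.elim xs default]
    exact BoundedFormula.realize_iff.2 this

/-- If no development were equivalent to `ψ`, compactness would give `N, h` refuting `ψ` but
satisfying all developments that follow from `ψ`, and then `M, g` satisfying `ψ` and the same
developments as `N, h`, against invariance. -/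
theorem SetEntails.exists_development {ψ : L.Formula ℕ}
    (hψ : SetEntails.{u, v, max u v w, w'} rigid Φ ψ) :
    ∃ θ : L.Formula ℕ, IsSetDevelopment rigid Φ θ ∧ LogicallyEquivalent ψ θ := by
  classical
  by_contra! hcon
  let Δ : Set (L.Formula ℕ) := {θ | IsSetDevelopment rigid Φ θ ∧
    ∀ (M : Type (max u v w)) [L.Structure M] [Nonempty M] (g : ℕ → M),
      ψ.Realize g → θ.Realize g}
  obtain ⟨N, strN, neN, h, hN⟩ := exists_realize_of_forall_finset.{u, v, 0, max u v w}
      (Δ ∪ {ψ.not}) (by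
    intro S₀
    obtain ⟨θ, hθ, hθe⟩ := exists_development_realize_iff_forall.{u, v, max u v w}
      (rigid := rigid) (Φ := Φ) (S₀.filter fun φ => φ.1 ∈ Δ) (fun φ => φ.1)
      (fun φ hφ => (Finset.mem_filter.1 hφ).2.1)
    -- The conjunction `θ` follows from `ψ` but is not equivalent to it, so somewhere `θ` holds
    -- without `ψ`.
    have := hcon θ hθ
    rw [logicallyEquivalent_iff.{u, v, w}] at this
    push Not at this
    obtain ⟨M, _, _, g, hg⟩ := this
    refine ⟨M, inferInstance, inferInstance, g, ?_⟩
    have hψθ : ψ.Realize g → θ.Realize g := fun h => (hθe M g).2 fun φ hφ =>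
      (Finset.mem_filter.1 hφ).2.2 M g h
    have hg' : ¬ ψ.Realize g ∧ θ.Realize g := by tauto
    rintro ⟨φ, hφ | rfl⟩ hmem
    · exact (hθe M g).1 hg'.2 _ (Finset.mem_filter.2 ⟨hmem, hφ⟩)
    · exact Formula.realize_not.2 hg'.1)
  obtain ⟨M, strM, neM, g, hM⟩ := exists_realize_of_forall_finset.{u, v, 0, max u v w}
      ({θ | IsSetDevelopment rigid Φ θ ∧ θ.Realize h} ∪ {ψ}) (by
    intro S₀
    let D : Set (L.Formula ℕ) := {θ | IsSetDevelopment rigid Φ θ ∧ θ.Realize h}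
    obtain ⟨θ, hθ, hθe⟩ := exists_development_realize_iff_forall.{u, v, max u v w}
      (rigid := rigid) (Φ := Φ) (S₀.filter fun φ => φ.1 ∈ D) (fun φ => φ.1)
      (fun φ hφ => (Finset.mem_filter.1 hφ).2.1)
    by_contra hc
    -- Were `θ` inconsistent with `ψ`, its negation would follow from `ψ` and so hold at `h`, where
    -- `θ` holds.
    have hΔ : Formula.not θ ∈ Δ := by
      refine ⟨hθ.not, fun M _ _ g hg => Formula.realize_not.2 fun hgθ => hc ?_⟩
      refine ⟨M, inferInstance, inferInstance, g, ?_⟩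
      rintro ⟨φ, hφ | rfl⟩ hmem
      · exact (hθe M g).1 hgθ _ (Finset.mem_filter.2 ⟨hmem, hφ⟩)
      · exact hg
    refine Formula.realize_not.1 (hN _ (.inl hΔ)) ((hθe N h).2 fun φ hφ => ?_)
    exact (Finset.mem_filter.1 hφ).2.2)
  have key : ∀ θ : L.Formula ℕ, IsSetDevelopment rigid Φ θ → (θ.Realize g ↔ θ.Realize h) := by
    intro θ hθ
    refine ⟨fun hg => ?_, fun hh => hM θ (.inl ⟨hθ, hh⟩)⟩
    by_contra hc
    exact Formula.realize_not.1 (hM _ (.inl ⟨hθ.not, Formula.realize_not.2 hc⟩)) hg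
  have H : SameDevelopments rigid Φ g h := by
    intro θ hθ r
    obtain ⟨θ', hθ', e⟩ := hθ.exists_rename.{u, v, max u v w} r
    rw [← e M g, ← e N h, key θ' hθ']
  exact Formula.realize_not.1 (hN _ (.inr rfl)) ((hψ.realize_iff H).1 (hM _ (.inr rfl)))

theorem setEntails_iff_exists_development {ψ : L.Formula ℕ} :
    SetEntails.{u, v, max u v w, w'} rigid Φ ψ ↔
      ∃ θ : L.Formula ℕ, IsSetDevelopment rigid Φ θ ∧ LogicallyEquivalent ψ θ := by
  refine ⟨SetEntails.exists_development.{u, v, w, w'}, ?_⟩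
  rintro ⟨θ, hθ, he⟩ M ⟨a, b⟩ hab g
  have := M.domain_nonempty
  have he' := logicallyEquivalent_iff.{u, v, w}.1 he
  exact (@he' M.Domain (M.interp a) _ g).trans ((hθ.realize_iff M hab g default).trans
    (@he' M.Domain (M.interp b) _ g).symm)

theorem entails_iff_setEntails_singleton {φ ψ : L.Formula ℕ} :
    Entails.{u, v, w, w'} rigid φ ψ ↔ SetEntails.{u, v, w, w'} rigid {φ} ψ := by
  simp [Entails, SetEntails, ModalModel.setPartition]

end Interrogation

theorem mainTheorem2 (L : FirstOrder.Language.{u, v}) (rigid : ∀ n, L.Functions n → Prop)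
    (ψ : L.Formula ℕ) (hψ : Interrogation.IsSentence ψ) :
    (∀ φ : L.Formula ℕ,
      Interrogation.IsAnswer.{u, v, max u v w, w'} rigid φ ψ ↔
        ∃ θ : L.Formula ℕ, Interrogation.IsDevelopment rigid φ θ ∧
          Interrogation.LogicallyEquivalent ψ θ) ∧
    (∀ Φ : Set (L.Formula ℕ),
      Interrogation.IsAnswerToSet.{u, v, max u v w, w'} rigid Φ ψ ↔
        ∃ θ : L.Formula ℕ, Interrogation.IsSetDevelopment rigid Φ θ ∧
          Interrogation.LogicallyEquivalent ψ θ) := by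
  have key : ∀ Φ : Set (L.Formula ℕ),
      Interrogation.IsAnswerToSet.{u, v, max u v w, w'} rigid Φ ψ ↔
        ∃ θ : L.Formula ℕ, Interrogation.IsSetDevelopment rigid Φ θ ∧
          Interrogation.LogicallyEquivalent ψ θ := fun Φ =>
    (and_iff_right hψ).trans Interrogation.setEntails_iff_exists_development.{u, v, w, w'}
  refine ⟨fun φ => Iff.trans ?_ (key {φ}), key⟩
  exact and_congr_right fun _ => Interrogation.entails_iff_setEntails_singleton
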